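/- Let $k\ge 3$ be an odd integer. There is a constant $c>0$, depending only on $k$, such that for every integer $n>1$ there exist a set $P$ of $n$ points and a set $\mathcal L$ of $n$ lines in the real plane $\mathbb R^2$ with the following two properties. (a) The incidence graph of $(P,\mathcal L)$, that is, the bipartite graph with vertex parts $P$ and $\mathcal L$ in which $p\in P$ and $\ell\in\mathcal L$ are adjacent if and only if $p\in\ell$, has girth at least $k+5$; here the girth of a graph is the length of its shortest cycle, and it is $\infty$ if the graph has no cycle. (b) The number of incidences satisfies $$\bigl|\{(p,\ell)\in P\times\mathcal L : p\in\ell\}\bigr| \;\ge\; c\, n^{1+\frac{4}{k^2+6k-3}}.$$ -/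

import Mathlib

namespace PlaneIncidence

/-- The real plane. -/
abbrev Plane : Type := EuclideanSpace ℝ (Fin 2)

/-- A line in the plane: a nonempty affine subspace of dimension one. -/
def IsLine (l : AffineSubspace ℝ Plane) : Prop :=
  (l : Set Plane).Nonempty ∧ Module.finrank ℝ l.direction = 1

/-- The set `I(P, L)` of incidences, the pairs `(p, l)` in `P × L` with `p` on `l`. -/
def incidences (P : Finset Plane) (L : Finset (AffineSubspace ℝ Plane)) :
    Set (Plane × AffineSubspace ℝ Plane) :=
  {x | x.1 ∈ P ∧ x.2 ∈ L ∧ x.1 ∈ x.2}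

/-- The bipartite incidence graph of `(P, L)`: the vertex set is the disjoint union of `P` and `L`,
and a point is joined to a line exactly when it lies on that line. -/
def incidenceGraph (P : Finset Plane) (L : Finset (AffineSubspace ℝ Plane)) :
    SimpleGraph (P ⊕ L) where
  Adj
    | Sum.inl p, Sum.inr l => p.1 ∈ l.1
    | Sum.inr l, Sum.inl p => p.1 ∈ l.1
    | _, _ => False
  symm := ⟨by rintro (p | l) (p' | l') h <;> exact h⟩
  loopless := ⟨by rintro (p | l) h <;> exact h⟩

end PlaneIncidence

/-!
The configuration is a projection of an algebraically defined bipartite graph in the manner of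
Lazebnik and Ustimenko, written here as a coset graph.

Put `k = 2 * u + 3` and `s = u + 3`. Consider the algebra generated by two letters of square zero,
with basis the alternating words, truncated beyond length `s`. A letter `Z` generates the
one-parameter group of the elements `1 + c Z`. Points are cosets of the group of one letter, lines
are cosets of the group of the other, and they are incident if the cosets meet. A cycle of length
`2 * j` is an alternating product of `2 * j` nontrivial factors `1 + c Z` equal to `1`. Moving half
of the factors to the other side gives two products of `j` factors that begin with different letters.
The word of length `j` beginning with the first letter has a nonzero coefficient in one of them and
does not occur in the other, so there is no cycle with `j ≤ s`, and the girth is at least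
`2 * s + 2 = k + 5` (`not_closed_of_alternating`, `not_closed_of_incident`). Only one of the two words
of length `s` has to be kept.

With the words graded by length, a point or line has `k` coordinates, of weights
`1, 2, 3, 3, 4, 4, …, s - 1, s - 1, s`, whose sum is `D = (k ^ 2 + 6 * k - 3) / 4`
(`four_mul_totalWeight`). Each coordinate of a point on a given line is an affine function of the
coordinate `x` numbered `0`, so that the lines of the graph are lines in `ℝ ^ k`. Letting a coordinate
of weight `w` range over an interval of length about `m ^ w` gives `m ^ D` lines with `m` points each,
and a constant times `m ^ D` points in total, hence `m ^ (D + 1)` incidences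
(`exists_configuration`).

The projection `q ↦ (q 0, ∑ i, q i * τ ^ i)` with `τ` transcendental is injective on integer points and
creates no new incidences with the projected lines, since an incidence is the vanishing of an integer
polynomial at `τ` (`mem_planarLine`). Isolated points and lines bring the sizes to exactly `n`
(`exists_isolated_extension`).
-/

namespace PlaneIncidence

open Matrix

/-! ### Alternating products of elementary unipotent matrices -/

/-- The sum of the matrix units `E (i, i + 1)` over the rows `i` of parity `e`. The words without
repeated letters in `stepUnit N 0` and `stepUnit N 1` satisfy no relation other than the vanishing
of the words that are too long. -/
def stepUnit (N e : ℕ) : Matrix (Fin N) (Fin N) ℤ :=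
  Matrix.of fun i j => if i.1 + 1 = j.1 ∧ i.1 % 2 = e then 1 else 0

/-- The one-parameter unipotent group `1 + c Z` generated by `Z = stepUnit N e`. -/
def step (N e : ℕ) (c : ℤ) : Matrix (Fin N) (Fin N) ℤ := 1 + c • stepUnit N e

lemma stepUnit_mul_self (N e : ℕ) : stepUnit N e * stepUnit N e = 0 := by
  ext i j
  rw [Matrix.mul_apply]
  refine Finset.sum_eq_zero fun l _ => ?_
  simp only [stepUnit, Matrix.of_apply]
  split_ifs <;> omega

lemma step_mul_step (N e : ℕ) (c d : ℤ) : step N e c * step N e d = step N e (c + d) := by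
  simp only [step, add_mul, mul_add, one_mul, mul_one, smul_mul_smul_comm, stepUnit_mul_self,
    smul_zero, add_zero, add_smul]
  abel

@[simp] lemma step_zero (N e : ℕ) : step N e 0 = 1 := by simp [step]

lemma isUnit_step (N e : ℕ) (c : ℤ) : IsUnit (step N e c) :=
  ⟨⟨step N e c, step N e (-c), by simp [step_mul_step], by simp [step_mul_step]⟩, rfl⟩

lemma mul_stepUnit_apply_zero {N e : ℕ} (A : Matrix (Fin N) (Fin N) ℤ) (i : Fin N) (h : 0 < N) :
    (A * stepUnit N e) i ⟨0, h⟩ = 0 := by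
  rw [Matrix.mul_apply]
  exact Finset.sum_eq_zero fun l _ => by simp [stepUnit]

lemma mul_stepUnit_apply_succ {N e : ℕ} (A : Matrix (Fin N) (Fin N) ℤ) (i : Fin N) (j : ℕ)
    (h : j + 1 < N) : (A * stepUnit N e) i ⟨j + 1, h⟩ =
      if j % 2 = e then A i ⟨j, by omega⟩ else 0 := by
  rw [Matrix.mul_apply, Finset.sum_eq_single (⟨j, by omega⟩ : Fin N)]
  · simp [stepUnit]
  · intro b _ hb
    have : b.1 ≠ j := fun h => hb (Fin.ext h)
    simp [stepUnit, this]
  · simp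

lemma mul_step_apply_zero {N e : ℕ} {c : ℤ} (A : Matrix (Fin N) (Fin N) ℤ) (i : Fin N)
    (h : 0 < N) : (A * step N e c) i ⟨0, h⟩ = A i ⟨0, h⟩ := by
  rw [step, mul_add, mul_one, Matrix.mul_smul, Matrix.add_apply, Matrix.smul_apply,
    mul_stepUnit_apply_zero, smul_zero, add_zero]

lemma mul_step_apply_succ {N e : ℕ} {c : ℤ} (A : Matrix (Fin N) (Fin N) ℤ) (i : Fin N) (j : ℕ)
    (h : j + 1 < N) : (A * step N e c) i ⟨j + 1, h⟩ =
      A i ⟨j + 1, h⟩ + if j % 2 = e then c * A i ⟨j, by omega⟩ else 0 := by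
  rw [step, mul_add, mul_one, Matrix.mul_smul, Matrix.add_apply, Matrix.smul_apply,
    mul_stepUnit_apply_succ, smul_ite, smul_zero, smul_eq_mul]

/-- A closed sequence of `2 * j` alternating steps, the first `j` of which are nontrivial, does not
exist in size `N > j`. The two halves of the sequence multiply the initial matrix by an
alternating word that begins with `stepUnit N 0` and by one that begins with `stepUnit N 1`, and
only the former has a nonzero entry at `(0, j)`. -/
theorem not_closed_of_alternating {N j : ℕ} (hj : 0 < j) (hjN : j < N)
    (f : ℕ → Matrix (Fin N) (Fin N) ℤ) (c : ℕ → ℤ) (hf : IsUnit (f 0))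
    (hstep : ∀ n < 2 * j, f (n + 1) = f n * step N (n % 2) (c n))
    (hc : ∀ n < j, c n ≠ 0) : f (2 * j) ≠ f 0 := by
  intro hclosed
  let o : Fin N := ⟨0, by omega⟩
  have fwd : ∀ n ≤ j, ∃ W : Matrix (Fin N) (Fin N) ℤ, f n = f 0 * W ∧
      (∀ l (hl : l < N), n < l → W o ⟨l, hl⟩ = 0) ∧ ∀ hn : n < N, W o ⟨n, hn⟩ ≠ 0 := by
    intro n
    induction n with
    | zero =>
      refine fun _ => ⟨1, by simp, fun l hl h0 => ?_, fun hn => by simp [o]⟩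
      rw [Matrix.one_apply_ne]
      simp only [o, ne_eq, Fin.mk.injEq]
      omega
    | succ n ih =>
      intro hn
      obtain ⟨W, hW, hz, hne⟩ := ih (by omega)
      refine ⟨W * step N (n % 2) (c n), ?_, ?_, ?_⟩
      · rw [hstep n (by omega), hW, mul_assoc]
      · intro l hl hnl
        obtain ⟨l, rfl⟩ : ∃ l', l = l' + 1 := ⟨l - 1, by omega⟩
        rw [mul_step_apply_succ, hz _ _ (by omega), hz _ _ (by omega)]
        simp
      · intro hn'
        rw [mul_step_apply_succ, hz _ _ (by omega), if_pos rfl, zero_add]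
        exact mul_ne_zero (hc n (by omega)) (hne (by omega))
  have bwd : ∀ n ≤ j, ∃ W : Matrix (Fin N) (Fin N) ℤ, f (2 * j - n) = f 0 * W ∧
      ∀ l (hl : l < N), 0 < l → n ≤ l → W o ⟨l, hl⟩ = 0 := by
    intro n
    induction n with
    | zero =>
      refine fun _ => ⟨1, by simpa using hclosed, fun l hl h0 _ => ?_⟩
      rw [Matrix.one_apply_ne]
      simp only [o, ne_eq, Fin.mk.injEq]
      omega
    | succ n ih =>
      intro hn
      obtain ⟨W, hW, hz⟩ := ih (by omega)
      have hs := hstep (2 * j - (n + 1)) (by omega)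
      rw [show 2 * j - (n + 1) + 1 = 2 * j - n by omega, hW] at hs
      refine ⟨W * step N ((2 * j - (n + 1)) % 2) (-c (2 * j - (n + 1))), ?_, ?_⟩
      · rw [← mul_assoc, hs, mul_assoc, step_mul_step]
        simp
      · intro l hl _ hnl
        obtain ⟨l, rfl⟩ : ∃ l', l = l' + 1 := ⟨l - 1, by omega⟩
        rw [mul_step_apply_succ, hz _ _ (by omega) (by omega), zero_add]
        -- for `n = 0` the step is made by `stepUnit N 1`, which leaves row `0` as it is
        split_ifs with hpar
        · rw [hz _ _ (by omega) (by omega), mul_zero]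
        · rfl
  obtain ⟨W, hW, -, hne⟩ := fwd j le_rfl
  obtain ⟨W', hW', hz⟩ := bwd j le_rfl
  rw [show 2 * j - j = j by omega, hW] at hW'
  rw [hf.mul_left_cancel hW'] at hne
  exact hne hjN (hz j hjN hj le_rfl)

/-! ### The algebraically defined incidence graph -/

section Coordinates

variable {u : ℕ}

/-- The `i`-th coordinate of an integer vector of length `2 * u + 3`, or `0` beyond its length. -/
def coord (t : Fin (2 * u + 3) → ℤ) (i : ℕ) : ℤ := if h : i < 2 * u + 3 then t ⟨i, h⟩ else 0

lemma ext_coord {t t' : Fin (2 * u + 3) → ℤ} (h : ∀ i < 2 * u + 3, coord t i = coord t' i) :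
    t = t' := by
  ext ⟨i, hi⟩
  simpa [coord, hi] using h i hi

/-- The coefficient of the alternating word of length `w` beginning with letter `r` in the element
that represents the line with coordinate vector `t`. A line is a coset of the one-parameter group of
letter `1`, and its representative is the element of the coset in which the word consisting of the
letter `1` has coefficient `0`. The two words of length two have opposite coefficients, so they
share coordinate `1`. -/
def lineEntry (t : Fin (2 * u + 3) → ℤ) : ℕ → ℕ → ℤ
  | _, 0 => 1
  | 0, 1 => coord t 0
  | 0, 2 => coord t 1
  | 0, w + 3 => coord t (2 * w + 2)
  | _ + 1, 1 => 0
  | _ + 1, 2 => -coord t 1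
  | _ + 1, w + 3 => coord t (2 * w + 3)

/-- The coefficient of the alternating word of length `w` beginning with letter `r` in the element
that represents the point with coordinate vector `q`. A point is a coset of the one-parameter group
of letter `0`, and its representative is the element of the coset in which the word consisting of
the letter `0` has coefficient `0`. -/
def pointEntry (q : Fin (2 * u + 3) → ℤ) : ℕ → ℕ → ℤ
  | _, 0 => 1
  | 0, 1 => 0
  | 0, 2 => coord q 1
  | 0, w + 3 => coord q (2 * w + 2)
  | _ + 1, 1 => coord q 0
  | _ + 1, 2 => -coord q 1
  | _ + 1, w + 3 => coord q (2 * w + 3)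

/-- The matrix of right multiplication by an element of the algebra of alternating words in the
letters `0` and `1`, where `E r w` is the coefficient of the word of length `w` that begins with
letter `r`. It acts on the quotient of the algebra by the words that begin with letter `1` or are
longer than `u + 3`; row and column `i` belong to the word of length `i` that begins with letter
`0`. -/
def bandMatrix (u : ℕ) (E : ℕ → ℕ → ℤ) : Matrix (Fin (u + 4)) (Fin (u + 4)) ℤ :=
  Matrix.of fun i j => if i.1 ≤ j.1 then E (i.1 % 2) (j.1 - i.1) else 0

lemma isUnit_bandMatrix {E : ℕ → ℕ → ℤ} (hE : ∀ r, E r 0 = 1) : IsUnit (bandMatrix u E) := by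
  rw [Matrix.isUnit_iff_isUnit_det, Matrix.det_of_isUpperTriangular]
  · simp [bandMatrix, hE]
  · intro i j hij
    exact if_neg (not_le.mpr hij)

/-- The letter with which the word belonging to coordinate `i` of a point begins. For lines this
holds for `i ≠ 0` only: their coordinate `0` belongs to the word consisting of the letter `0`. -/
def slotRow (i : ℕ) : ℕ := if i = 0 then 1 else if i = 1 then 0 else i % 2

/-- The length of the word belonging to coordinate `i`. -/
def slotWeight (i : ℕ) : ℕ := if i = 0 then 1 else (i + 4) / 2

/-- The value at `x = 0` of coordinate `i` of the points of the line `t`, as an affine function of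
the coordinate `x` numbered `0`. -/
def intercept (t : Fin (2 * u + 3) → ℤ) (i : ℕ) : ℤ :=
  if (slotRow i + slotWeight i) % 2 = 0 then lineEntry t (slotRow i) (slotWeight i)
  else lineEntry t (slotRow i) (slotWeight i) -
    coord t 0 * lineEntry t (slotRow i) (slotWeight i - 1)

/-- The slope of coordinate `i` of the points of the line `t`, as an affine function of
the coordinate `x` numbered `0`. -/
def slope (t : Fin (2 * u + 3) → ℤ) (i : ℕ) : ℤ :=
  if (slotRow i + slotWeight i) % 2 = 0 then lineEntry t (slotRow i) (slotWeight i - 1)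
  else -(coord t 0 * lineEntry t (slotRow i) (slotWeight i - 2))

/-- Incidence of the point `q` and the line `t` in `ℤ ^ (2 * u + 3)`. -/
def Incident (t q : Fin (2 * u + 3) → ℤ) : Prop :=
  ∀ i < 2 * u + 3, coord q i = intercept t i + coord q 0 * slope t i

/-- Along the coset of the line, the coefficient of a word that ends with letter `1` changes by a
multiple of the coefficient of the word without its last letter. -/
lemma Incident.pointEntry_of_even {t q : Fin (2 * u + 3) → ℤ} (h : Incident t q) {r w : ℕ}
    (hr : r < 2) (hw : r + w < u + 3) (hpar : (r + w + 1) % 2 = 0) :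
    pointEntry q r (w + 1) = lineEntry t r (w + 1) + coord q 0 * lineEntry t r w := by
  interval_cases r
  · match w with
    | 0 => omega
    | 1 => simpa [pointEntry, slotRow, slotWeight, intercept, slope] using h 1 (by omega)
    | w + 2 =>
      have h1 := h (2 * w + 2) (by omega)
      have e1 : slotRow (2 * w + 2) = 0 := by simp [slotRow]
      have e2 : slotWeight (2 * w + 2) = w + 3 := by
        simp only [slotWeight, Nat.add_eq_zero_iff, if_neg (show ¬ (2 * w = 0 ∧ 2 = 0) by omega)]
        omega
      rw [intercept, slope, e1, e2, if_pos (by omega), if_pos (by omega)] at h1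
      exact h1
  · match w with
    | 0 => simp [pointEntry, lineEntry]
    | 1 => omega
    | w + 2 =>
      have h1 := h (2 * w + 3) (by omega)
      have e1 : slotRow (2 * w + 3) = 1 := by simp [slotRow]
      have e2 : slotWeight (2 * w + 3) = w + 3 := by
        simp only [slotWeight, Nat.add_eq_zero_iff, if_neg (show ¬ (2 * w = 0 ∧ 3 = 0) by omega)]
        omega
      rw [intercept, slope, e1, e2, if_pos (by omega), if_pos (by omega)] at h1
      exact h1

/-- Along the coset of the point, the coefficient of a word that ends with letter `0` changes by a
multiple of the coefficient of the word without its last letter. -/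
lemma Incident.pointEntry_of_odd {t q : Fin (2 * u + 3) → ℤ} (h : Incident t q) {r w : ℕ}
    (hr : r < 2) (hw : r + w < u + 3) (hpar : (r + w + 1) % 2 = 1) :
    pointEntry q r (w + 1) = lineEntry t r (w + 1) - coord t 0 * pointEntry q r w := by
  interval_cases r
  · match w with
    | 0 => simp [pointEntry, lineEntry]
    | 1 => omega
    | w + 2 =>
      have h1 := h (2 * w + 2) (by omega)
      have e1 : slotRow (2 * w + 2) = 0 := by simp [slotRow]
      have e2 : slotWeight (2 * w + 2) = w + 3 := by
        simp only [slotWeight, Nat.add_eq_zero_iff, if_neg (show ¬ (2 * w = 0 ∧ 2 = 0) by omega)]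
        omega
      rw [intercept, slope, e1, e2, if_neg (by omega), if_neg (by omega)] at h1
      rw [h.pointEntry_of_even (w := w + 1) hr (by omega) (by omega)]
      change coord q (2 * w + 2) = _
      rw [h1, show w + 3 - 1 = w + 1 + 1 by omega, show w + 3 - 2 = w + 1 by omega]
      ring
  · match w with
    | 0 => omega
    | 1 =>
      have h1 : coord q 1 = coord t 1 + coord q 0 * coord t 0 := by
        simpa [lineEntry, slotRow, slotWeight, intercept, slope] using h 1 (by omega)
      simp only [pointEntry, lineEntry, h1]
      ring
    | w + 2 =>
      have h1 := h (2 * w + 3) (by omega)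
      have e1 : slotRow (2 * w + 3) = 1 := by simp [slotRow]
      have e2 : slotWeight (2 * w + 3) = w + 3 := by
        simp only [slotWeight, Nat.add_eq_zero_iff, if_neg (show ¬ (2 * w = 0 ∧ 3 = 0) by omega)]
        omega
      rw [intercept, slope, e1, e2, if_neg (by omega), if_neg (by omega)] at h1
      rw [h.pointEntry_of_even (w := w + 1) hr (by omega) (by omega)]
      change coord q (2 * w + 3) = _
      rw [h1, show w + 3 - 1 = w + 1 + 1 by omega, show w + 3 - 2 = w + 1 by omega]
      ring

/-- An incident pair is an element common to the coset of its line and the coset of its point. -/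
lemma Incident.flag_eq {t q : Fin (2 * u + 3) → ℤ} (h : Incident t q) :
    bandMatrix u (lineEntry t) * step (u + 4) 1 (coord q 0) =
      bandMatrix u (pointEntry q) * step (u + 4) 0 (coord t 0) := by
  ext ⟨i, hi⟩ ⟨j, hj⟩
  match j with
  | 0 =>
    rw [mul_step_apply_zero, mul_step_apply_zero]
    simp [bandMatrix, lineEntry, pointEntry]
  | j + 1 =>
    rw [mul_step_apply_succ, mul_step_apply_succ]
    simp only [bandMatrix, Matrix.of_apply]
    rcases lt_trichotomy i (j + 1) with hij | rfl | hij
    · obtain ⟨w, rfl⟩ : ∃ w, j = i + w := ⟨j - i, by omega⟩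
      simp only [show i ≤ i + w + 1 by omega, show i ≤ i + w by omega, if_true,
        show i + w + 1 - i = w + 1 by omega, show i + w - i = w by omega]
      by_cases hpar : (i + w) % 2 = 1
      · rw [if_pos hpar, if_neg (by omega),
          h.pointEntry_of_even (Nat.mod_lt _ (by omega)) (by omega) (by omega), add_zero]
      · rw [if_neg hpar, if_pos (by omega),
          h.pointEntry_of_odd (Nat.mod_lt _ (by omega)) (by omega) (by omega)]
        ring
    · simp [lineEntry, pointEntry]
    · simp [show ¬ i ≤ j + 1 by omega, show ¬ i ≤ j by omega]

lemma lineEntry_injective {t t' : Fin (2 * u + 3) → ℤ}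
    (h : bandMatrix u (lineEntry t) = bandMatrix u (lineEntry t')) : t = t' := by
  have key : ∀ r w, r < 2 → r + w < u + 4 → lineEntry t r w = lineEntry t' r w := by
    intro r w hr hw
    have := congrFun (congrFun h ⟨r, by omega⟩) ⟨r + w, hw⟩
    simpa [bandMatrix, Nat.mod_eq_of_lt hr] using this
  refine ext_coord fun i hi => ?_
  match i with
  | 0 => exact key 0 1 (by omega) (by omega)
  | 1 => exact key 0 2 (by omega) (by omega)
  | i + 2 =>
    rcases Nat.even_or_odd' i with ⟨w, rfl | rfl⟩
    · exact key 0 (w + 3) (by omega) (by omega)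
    · exact key 1 (w + 3) (by omega) (by omega)

lemma pointEntry_injective {q q' : Fin (2 * u + 3) → ℤ}
    (h : bandMatrix u (pointEntry q) = bandMatrix u (pointEntry q')) : q = q' := by
  have key : ∀ r w, r < 2 → r + w < u + 4 → pointEntry q r w = pointEntry q' r w := by
    intro r w hr hw
    have := congrFun (congrFun h ⟨r, by omega⟩) ⟨r + w, hw⟩
    simpa [bandMatrix, Nat.mod_eq_of_lt hr] using this
  refine ext_coord fun i hi => ?_
  match i with
  | 0 => exact key 1 1 (by omega) (by omega)
  | 1 => exact key 0 2 (by omega) (by omega)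
  | i + 2 =>
    rcases Nat.even_or_odd' i with ⟨w, rfl | rfl⟩
    · exact key 0 (w + 3) (by omega) (by omega)
    · exact key 1 (w + 3) (by omega) (by omega)

/-- Two lines through a common point are equal if their coordinates numbered `0` are. -/
lemma Incident.line_eq {t t' q : Fin (2 * u + 3) → ℤ} (h : Incident t q) (h' : Incident t' q)
    (h0 : coord t 0 = coord t' 0) : t = t' := by
  refine lineEntry_injective ((isUnit_step (u + 4) 1 (coord q 0)).mul_right_cancel ?_)
  rw [h.flag_eq, h'.flag_eq, h0]

/-- Two points of a common line are equal if their coordinates numbered `0` are. -/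
lemma Incident.point_eq {t q q' : Fin (2 * u + 3) → ℤ} (h : Incident t q) (h' : Incident t q')
    (h0 : coord q 0 = coord q' 0) : q = q' := by
  refine pointEntry_injective ((isUnit_step (u + 4) 0 (coord t 0)).mul_right_cancel ?_)
  rw [← h.flag_eq, ← h'.flag_eq, h0]

/-- The incidence graph has no closed path `t 0, q 0, t 1, q 1, …, t j = t 0` without backtracking
of length `2 * j` with `2 ≤ j ≤ u + 3`. -/
theorem not_closed_of_incident {j : ℕ} (hj : 2 ≤ j) (hju : j ≤ u + 3)
    (t q : ℕ → Fin (2 * u + 3) → ℤ) (h : ∀ i < j, Incident (t i) (q i))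
    (h' : ∀ i < j, Incident (t (i + 1)) (q i)) (ht : ∀ i < j, t i ≠ t (i + 1))
    (hq : ∀ i, i + 1 < j → q i ≠ q (i + 1)) (hclosed : t j = t 0) : False := by
  -- the flags along the path; the last point of the closed path is its first
  let p : ℕ → Fin (2 * u + 3) → ℤ := fun i => if i = j then q 0 else q i
  have hp : ∀ i < j, p i = q i := fun i hi => if_neg hi.ne
  have hinc : ∀ i ≤ j, Incident (t i) (p i) := by
    intro i hi
    rcases hi.eq_or_lt with rfl | hi
    · rw [hclosed]
      simpa [p] using h 0 (by omega)
    · rw [hp i hi]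
      exact h i hi
  have hinc' : ∀ i < j, Incident (t (i + 1)) (p i) := fun i hi => by rw [hp i hi]; exact h' i hi
  let f : ℕ → Matrix (Fin (u + 4)) (Fin (u + 4)) ℤ := fun n =>
    bandMatrix u (lineEntry (t ((n + 1) / 2))) * step (u + 4) 1 (coord (p (n / 2)) 0)
  let c : ℕ → ℤ := fun n => if n % 2 = 0 then coord (t (n / 2 + 1)) 0 - coord (t (n / 2)) 0
    else coord (p (n / 2 + 1)) 0 - coord (p (n / 2)) 0
  refine not_closed_of_alternating (N := u + 4) (j := j) (by omega) (by omega) f c ?_ ?_ ?_ ?_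
  · exact (isUnit_bandMatrix fun r => by simp [lineEntry]).mul (isUnit_step _ _ _)
  · intro n hn
    rcases Nat.even_or_odd' n with ⟨i, rfl | rfl⟩
    · have e1 : (2 * i + 1 + 1) / 2 = i + 1 := by omega
      have e2 : (2 * i + 1) / 2 = i := by omega
      have e3 : 2 * i / 2 = i := by omega
      have e4 : 2 * i % 2 = 0 := by omega
      simp only [f, c, e1, e2, e3, e4, if_true]
      rw [(hinc' i (by omega)).flag_eq, (hinc i (by omega)).flag_eq, mul_assoc, step_mul_step,
        add_sub_cancel]
    · have e1 : (2 * i + 1 + 1) / 2 = i + 1 := by omega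
      have e2 : (2 * i + 1) / 2 = i := by omega
      have e3 : (2 * i + 1 + 1 + 1) / 2 = i + 1 := by omega
      have e4 : (2 * i + 1) % 2 = 1 := by omega
      simp only [f, c, e1, e2, e3, e4, one_ne_zero, if_false]
      rw [mul_assoc, step_mul_step, add_sub_cancel]
  · intro n hn
    rcases Nat.even_or_odd' n with ⟨i, rfl | rfl⟩
    · have e3 : 2 * i / 2 = i := by omega
      have e4 : 2 * i % 2 = 0 := by omega
      simp only [c, e3, e4, if_true]
      exact fun h0 => ht i (by omega)
        ((h i (by omega)).line_eq (h' i (by omega)) (sub_eq_zero.mp h0).symm)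
    · have e2 : (2 * i + 1) / 2 = i := by omega
      have e4 : (2 * i + 1) % 2 = 1 := by omega
      simp only [c, e2, e4, one_ne_zero, if_false]
      rw [hp i (by omega), hp (i + 1) (by omega)]
      exact fun h0 => hq i (by omega)
        ((h' i (by omega)).point_eq (h (i + 1) (by omega)) (sub_eq_zero.mp h0).symm)
  · have e1 : (2 * j + 1) / 2 = j := by omega
    have e2 : 2 * j / 2 = j := by omega
    simp only [f, e1, e2, hclosed]
    simp [p]

/-! ### Projection to the plane -/

/-- The non-vertical line `y = m * x + c`. -/
noncomputable def graphLine (m c : ℝ) : AffineSubspace ℝ Plane :=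
  AffineSubspace.mk' !₂[0, c] (Submodule.span ℝ {!₂[1, m]})

/-- The vertical line `x = c`. -/
noncomputable def verticalLine (c : ℝ) : AffineSubspace ℝ Plane :=
  AffineSubspace.mk' !₂[c, 0] (Submodule.span ℝ {!₂[0, 1]})

lemma mem_graphLine {m c : ℝ} {p : Plane} : p ∈ graphLine m c ↔ p 1 = m * p 0 + c := by
  rw [graphLine, AffineSubspace.mem_mk', Submodule.mem_span_singleton]
  constructor
  · rintro ⟨a, ha⟩
    have h0 := congrArg (fun v : Plane => v 0) ha
    have h1 := congrArg (fun v : Plane => v 1) ha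
    simp at h0 h1
    rw [h0] at h1
    linarith
  · intro h
    refine ⟨p 0, ?_⟩
    ext i
    fin_cases i <;> simp [h]
    ring

lemma mem_verticalLine {c : ℝ} {p : Plane} : p ∈ verticalLine c ↔ p 0 = c := by
  rw [verticalLine, AffineSubspace.mem_mk', Submodule.mem_span_singleton]
  constructor
  · rintro ⟨a, ha⟩
    have h0 := congrArg (fun v : Plane => v 0) ha
    simp at h0
    linarith
  · intro h
    refine ⟨p 1, ?_⟩
    ext i
    fin_cases i <;> simp [h]

lemma isLine_graphLine (m c : ℝ) : IsLine (graphLine m c) := by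
  refine ⟨AffineSubspace.mk'_nonempty _ _, ?_⟩
  rw [graphLine, AffineSubspace.direction_mk']
  exact finrank_span_singleton fun h => by simpa using congrArg (fun v : Plane => v 0) h

lemma isLine_verticalLine (c : ℝ) : IsLine (verticalLine c) := by
  refine ⟨AffineSubspace.mk'_nonempty _ _, ?_⟩
  rw [verticalLine, AffineSubspace.direction_mk']
  exact finrank_span_singleton fun h => by simpa using congrArg (fun v : Plane => v 1) h

lemma graphLine_inj {m c m' c' : ℝ} (h : graphLine m c = graphLine m' c') : m = m' ∧ c = c' := by
  have h0 : (!₂[0, c] : Plane) ∈ graphLine m' c' := h ▸ mem_graphLine.mpr (by simp)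
  have h1 : (!₂[1, m + c] : Plane) ∈ graphLine m' c' := h ▸ mem_graphLine.mpr (by simp)
  rw [mem_graphLine] at h0 h1
  simp at h0 h1
  constructor <;> linarith

lemma verticalLine_injective : Function.Injective verticalLine := by
  intro c c' h
  have h0 : (!₂[c, 0] : Plane) ∈ verticalLine c' := h ▸ mem_verticalLine.mpr (by simp)
  simpa using mem_verticalLine.mp h0

lemma graphLine_ne_verticalLine (m c d : ℝ) : graphLine m c ≠ verticalLine d := by
  intro h
  have h0 : (!₂[d + 1, m * (d + 1) + c] : Plane) ∈ verticalLine d :=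
    h ▸ mem_graphLine.mpr (by simp)
  simpa using mem_verticalLine.mp h0

lemma eq_zero_of_sum_mul_pow_eq_zero {τ : ℝ} (hτ : Transcendental ℤ τ) {N : ℕ} {z : ℕ → ℤ}
    (h : ∑ i ∈ Finset.range N, (z i : ℝ) * τ ^ i = 0) {i : ℕ} (hi : i < N) : z i = 0 := by
  have hp : (∑ i ∈ Finset.range N, Polynomial.monomial i (z i)) = 0 := by
    refine (transcendental_iff.mp hτ) _ ?_
    simpa [map_sum, Polynomial.aeval_monomial] using h
  simpa [Polynomial.finsetSum_coeff, Polynomial.coeff_monomial, hi] using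
    congrArg (fun p => Polynomial.coeff p i) hp

lemma eq_of_sum_mul_pow_eq {τ : ℝ} (hτ : Transcendental ℤ τ) {N : ℕ} {z z' : ℕ → ℤ}
    (h : ∑ i ∈ Finset.range N, (z i : ℝ) * τ ^ i = ∑ i ∈ Finset.range N, (z' i : ℝ) * τ ^ i)
    {i : ℕ} (hi : i < N) : z i = z' i := by
  refine sub_eq_zero.mp (eq_zero_of_sum_mul_pow_eq_zero hτ (N := N) (z := fun i => z i - z' i) ?_ hi)
  simp [sub_mul, h]

/-- The projection of the integer point `q` to the plane along a direction given by powers of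
`τ`. For transcendental `τ` it creates no coincidences and no incidences. -/
noncomputable def planarPoint (τ : ℝ) (q : Fin (2 * u + 3) → ℤ) : Plane :=
  !₂[(coord q 0 : ℝ), ∑ i ∈ Finset.range (2 * u + 3), (coord q i : ℝ) * τ ^ i]

/-- The projection to the plane of the line with coordinate vector `t`. -/
noncomputable def planarLine (τ : ℝ) (t : Fin (2 * u + 3) → ℤ) : AffineSubspace ℝ Plane :=
  graphLine (∑ i ∈ Finset.range (2 * u + 3), (slope t i : ℝ) * τ ^ i)
    (∑ i ∈ Finset.range (2 * u + 3), (intercept t i : ℝ) * τ ^ i)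

/-- The point of the line `t` whose coordinate numbered `0` is `x`. -/
def pointOn (t : Fin (2 * u + 3) → ℤ) (x : ℤ) : Fin (2 * u + 3) → ℤ :=
  fun i => intercept t i + x * slope t i

@[simp] lemma coord_pointOn_zero (t : Fin (2 * u + 3) → ℤ) (x : ℤ) :
    coord (pointOn t x) 0 = x := by
  simp [coord, pointOn, intercept, slope, slotRow, slotWeight, lineEntry]

lemma incident_pointOn (t : Fin (2 * u + 3) → ℤ) (x : ℤ) : Incident t (pointOn t x) := by
  intro i hi
  rw [coord_pointOn_zero]
  simp [coord, hi, pointOn]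

lemma mem_planarLine {τ : ℝ} (hτ : Transcendental ℤ τ) {t q : Fin (2 * u + 3) → ℤ} :
    planarPoint τ q ∈ planarLine τ t ↔ Incident t q := by
  have e : (∑ i ∈ Finset.range (2 * u + 3), (slope t i : ℝ) * τ ^ i) * (coord q 0 : ℝ) +
      ∑ i ∈ Finset.range (2 * u + 3), (intercept t i : ℝ) * τ ^ i =
      ∑ i ∈ Finset.range (2 * u + 3),
        ((intercept t i + coord q 0 * slope t i : ℤ) : ℝ) * τ ^ i := by
    rw [Finset.sum_mul, ← Finset.sum_add_distrib]
    refine Finset.sum_congr rfl fun i _ => ?_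
    push_cast
    ring
  rw [planarLine, mem_graphLine, planarPoint]
  simp only [Matrix.cons_val_zero, Matrix.cons_val_one]
  rw [e]
  exact ⟨fun h i hi => eq_of_sum_mul_pow_eq hτ h hi,
    fun h => Finset.sum_congr rfl fun i hi => by rw [← h i (Finset.mem_range.mp hi)]⟩

lemma planarPoint_injective {τ : ℝ} (hτ : Transcendental ℤ τ) :
    Function.Injective (planarPoint (u := u) τ) := by
  intro q q' h
  have h1 := congrArg (fun v : Plane => v 1) h
  simp only [planarPoint, PiLp.toLp_apply, Matrix.cons_val_one] at h1
  exact ext_coord fun i hi => eq_of_sum_mul_pow_eq hτ h1 hi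

lemma planarLine_injective {τ : ℝ} (hτ : Transcendental ℤ τ) :
    Function.Injective (planarLine (u := u) τ) := by
  intro t t' h
  have h0 : Incident t' (pointOn t 0) :=
    (mem_planarLine hτ).mp (h ▸ (mem_planarLine hτ).mpr (incident_pointOn t 0))
  have h1 : slope t 1 = slope t' 1 := eq_of_sum_mul_pow_eq hτ (graphLine_inj h).1 (by omega)
  exact (incident_pointOn t 0).line_eq h0 h1

/-! ### Counting points and lines in a box -/

/-- The lines whose coordinates are nonnegative and bounded by powers of `m` according to their
weights. -/
noncomputable def lineBox (u m : ℕ) : Finset (Fin (2 * u + 3) → ℤ) :=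
  Fintype.piFinset fun i => Finset.Ico 0 ((m : ℤ) ^ slotWeight i)

/-- The total weight of the coordinates. -/
def totalWeight (u : ℕ) : ℕ := ∑ i ∈ Finset.range (2 * u + 3), slotWeight i

lemma four_mul_totalWeight (u : ℕ) :
    4 * totalWeight u + 3 = (2 * u + 3) ^ 2 + 6 * (2 * u + 3) := by
  induction u with
  | zero => decide
  | succ u ih =>
    have e : totalWeight (u + 1) = totalWeight u + (u + 3) + (u + 4) := by
      have h1 : slotWeight (2 * u + 3) = u + 3 := by simp [slotWeight]; omega
      have h2 : slotWeight (2 * u + 3 + 1) = u + 4 := by simp [slotWeight]; omega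
      rw [totalWeight, show 2 * (u + 1) + 3 = 2 * u + 3 + 1 + 1 by ring, Finset.sum_range_succ,
        Finset.sum_range_succ, h1, h2, totalWeight]
    rw [e]
    linarith [ih, show (2 * (u + 1) + 3) ^ 2 = (2 * u + 3) ^ 2 + 8 * u + 16 by ring]

lemma prod_pow_slotWeight (u m : ℕ) :
    ∏ i : Fin (2 * u + 3), m ^ slotWeight i = m ^ totalWeight u := by
  rw [Finset.prod_pow_eq_pow_sum, totalWeight, Fin.sum_univ_eq_sum_range]

lemma card_lineBox (u m : ℕ) : (lineBox u m).card = m ^ totalWeight u := by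
  rw [lineBox, Fintype.card_piFinset, ← prod_pow_slotWeight]
  refine Finset.prod_congr rfl fun i _ => ?_
  rw [Int.card_Ico, sub_zero]
  exact_mod_cast Int.toNat_natCast _

lemma abs_coord_le {m : ℕ} {t : Fin (2 * u + 3) → ℤ} (ht : t ∈ lineBox u m) (i : ℕ) :
    |coord t i| ≤ (m : ℤ) ^ slotWeight i := by
  unfold coord
  split_ifs with hi
  · have := Finset.mem_Ico.mp (Fintype.mem_piFinset.mp ht ⟨i, hi⟩)
    rw [abs_of_nonneg this.1]
    exact this.2.le
  · simp

lemma abs_lineEntry_le {m : ℕ} {t : Fin (2 * u + 3) → ℤ} (ht : t ∈ lineBox u m) (r w : ℕ) :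
    |lineEntry t r w| ≤ (m : ℤ) ^ w := by
  match r, w with
  | r, 0 => simp [lineEntry]
  | 0, 1 => simpa [lineEntry, slotWeight] using abs_coord_le ht 0
  | 0, 2 => simpa [lineEntry, slotWeight] using abs_coord_le ht 1
  | 0, w + 3 =>
    have e : slotWeight (2 * w + 2) = w + 3 := by simp [slotWeight]; omega
    simpa [lineEntry, e] using abs_coord_le ht (2 * w + 2)
  | r + 1, 1 => simp [lineEntry]
  | r + 1, 2 => simpa [lineEntry, slotWeight] using abs_coord_le ht 1
  | r + 1, w + 3 =>
    have e : slotWeight (2 * w + 3) = w + 3 := by simp [slotWeight]; omega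
    simpa [lineEntry, e] using abs_coord_le ht (2 * w + 3)

lemma abs_pointOn_le {m : ℕ} {t : Fin (2 * u + 3) → ℤ} (ht : t ∈ lineBox u m) {x : ℤ}
    (hx : |x| ≤ m) (i : Fin (2 * u + 3)) : |pointOn t x i| ≤ 3 * (m : ℤ) ^ slotWeight i := by
  have hm : (0 : ℤ) ≤ m := by positivity
  have hE := abs_lineEntry_le ht (slotRow i)
  have h0 : |coord t 0| ≤ (m : ℤ) := by simpa [slotWeight] using abs_coord_le ht 0
  have hmul : ∀ {a b : ℤ} {v : ℕ}, |a| ≤ (m : ℤ) → |b| ≤ (m : ℤ) ^ v →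
      |a * b| ≤ (m : ℤ) ^ (v + 1) := by
    intro a b v ha hb
    rw [abs_mul, pow_succ']
    gcongr
  rw [pointOn, intercept, slope]
  obtain ⟨w, hw⟩ : ∃ w, slotWeight i = w + 1 := ⟨slotWeight i - 1, by
    unfold slotWeight; split_ifs <;> omega⟩
  rw [hw, show w + 1 - 1 = w by omega]
  split_ifs with hpar
  · refine (abs_add_le _ _).trans ?_
    have h1 := hE (w + 1)
    have h2 := hmul hx (hE w)
    have h3 : (0 : ℤ) ≤ (m : ℤ) ^ (w + 1) := by positivity
    linarith
  · obtain ⟨v, rfl⟩ : ∃ v, w = v + 1 := ⟨w - 1, by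
      have : w ≠ 0 := by
        rintro rfl
        unfold slotWeight slotRow at *
        split_ifs at * <;> omega
      omega⟩
    rw [show v + 1 + 1 - 2 = v by omega]
    have h1 := hE (v + 1 + 1)
    have h2 := hmul h0 (hE (v + 1))
    have h3 := hmul hx (hmul h0 (hE v))
    rw [mul_neg]
    refine (abs_add_le _ _).trans ?_
    rw [abs_neg]
    have h4 := abs_sub (lineEntry t (slotRow i) (v + 1 + 1))
      (coord t 0 * lineEntry t (slotRow i) (v + 1))
    linarith

/-- The points on the lines of the box whose coordinate numbered `0` lies in `[0, m)`. -/
noncomputable def pointBox (u m : ℕ) : Finset (Fin (2 * u + 3) → ℤ) :=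
  (lineBox u m ×ˢ Finset.Ico (0 : ℤ) m).image fun x => pointOn x.1 x.2

lemma card_pointBox_one_le (u : ℕ) : (pointBox u 1).card ≤ 1 := by
  refine Finset.card_image_le.trans ?_
  simp [Finset.card_product, card_lineBox]

lemma card_pointBox_le {m : ℕ} (hm : 0 < m) :
    (pointBox u m).card ≤ 7 ^ (2 * u + 3) * m ^ totalWeight u := by
  have hsub : pointBox u m ⊆ Fintype.piFinset fun i : Fin (2 * u + 3) =>
      Finset.Icc (-(3 * (m : ℤ) ^ slotWeight i)) (3 * (m : ℤ) ^ slotWeight i) := by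
    intro q hq
    obtain ⟨⟨t, x⟩, hx, rfl⟩ := Finset.mem_image.mp hq
    obtain ⟨ht, hx⟩ := Finset.mem_product.mp hx
    have hx := Finset.mem_Ico.mp hx
    refine Fintype.mem_piFinset.mpr fun i => Finset.mem_Icc.mpr (abs_le.mp ?_)
    exact abs_pointOn_le ht ((abs_of_nonneg hx.1).trans_le hx.2.le) i
  refine (Finset.card_le_card hsub).trans ?_
  rw [Fintype.card_piFinset, ← prod_pow_slotWeight]
  calc _ ≤ ∏ i : Fin (2 * u + 3), 7 * m ^ slotWeight i := by
        refine Finset.prod_le_prod' fun i _ => ?_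
        have h1 : 1 ≤ m ^ slotWeight (i : ℕ) := Nat.one_le_pow _ _ hm
        rw [Int.card_Icc, Int.toNat_le]
        push_cast
        have h2 : (1 : ℤ) ≤ (m : ℤ) ^ slotWeight (i : ℕ) := by exact_mod_cast h1
        linarith
    _ = _ := by simp [Finset.prod_mul_distrib]

/-! ### Girth -/

lemma incidenceGraph_adj_inl {P : Finset Plane} {L : Finset (AffineSubspace ℝ Plane)} {p : P}
    {x : P ⊕ L} (h : (incidenceGraph P L).Adj (Sum.inl p) x) :
    ∃ l : L, x = Sum.inr l ∧ p.1 ∈ l.1 := by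
  rcases x with p' | l
  · exact h.elim
  · exact ⟨l, rfl, h⟩

lemma incidenceGraph_adj_inr {P : Finset Plane} {L : Finset (AffineSubspace ℝ Plane)} {l : L}
    {x : P ⊕ L} (h : (incidenceGraph P L).Adj (Sum.inr l) x) :
    ∃ p : P, x = Sum.inl p ∧ p.1 ∈ l.1 := by
  rcases x with p | l'
  · exact ⟨p, rfl, h⟩
  · exact h.elim

/-- The vertices of a cycle that starts at a line are alternately lines and points, and the cycle
lifts to a closed path without backtracking between integer vectors. -/
lemma le_length_of_isCycle {τ : ℝ} (hτ : Transcendental ℤ τ) {P : Finset Plane}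
    {L : Finset (AffineSubspace ℝ Plane)}
    (hPL : ∀ p ∈ P, ∀ l ∈ L, p ∈ l →
      ∃ t q : Fin (2 * u + 3) → ℤ, p = planarPoint τ q ∧ l = planarLine τ t)
    {l : L} (w : (incidenceGraph P L).Walk (Sum.inr l) (Sum.inr l)) (hw : w.IsCycle) :
    2 * u + 8 ≤ w.length := by
  by_contra! hlen
  have h3 := hw.three_le_length
  have hadj : ∀ i < w.length, (incidenceGraph P L).Adj (w.getVert i) (w.getVert (i + 1)) :=
    fun i hi => w.adj_getVert_succ hi
  -- even vertices are lines, odd vertices are points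
  have hpar : ∀ i, (2 * i ≤ w.length → ∃ l, w.getVert (2 * i) = Sum.inr l) ∧
      (2 * i + 1 ≤ w.length → ∃ p, w.getVert (2 * i + 1) = Sum.inl p) := by
    intro i
    have step : (2 * i ≤ w.length → ∃ l, w.getVert (2 * i) = Sum.inr l) →
        2 * i + 1 ≤ w.length → ∃ p, w.getVert (2 * i + 1) = Sum.inl p := by
      intro h hi
      obtain ⟨l, hl⟩ := h (by omega)
      obtain ⟨p, hp, -⟩ := incidenceGraph_adj_inr (hl ▸ hadj (2 * i) (by omega))
      exact ⟨p, hp⟩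
    suffices h : 2 * i ≤ w.length → ∃ l, w.getVert (2 * i) = Sum.inr l from ⟨h, step h⟩
    clear step
    induction i with
    | zero => exact fun _ => ⟨l, by simp⟩
    | succ i ih =>
      intro hi
      obtain ⟨l, hl⟩ := ih (by omega)
      obtain ⟨p, hp, -⟩ := incidenceGraph_adj_inr (hl ▸ hadj (2 * i) (by omega))
      obtain ⟨l', hl', -⟩ := incidenceGraph_adj_inl (hp ▸ hadj (2 * i + 1) (by omega))
      exact ⟨l', hl'⟩
  obtain ⟨j, hj⟩ : ∃ j, w.length = 2 * j := by
    rcases Nat.even_or_odd' w.length with ⟨j, hj | hj⟩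
    · exact ⟨j, hj⟩
    · obtain ⟨p, hp⟩ := (hpar j).2 hj.ge
      rw [← hj, w.getVert_length] at hp
      cases hp
  have hT : ∀ i, ∃ t : Fin (2 * u + 3) → ℤ, i < j →
      ∃ l : L, w.getVert (2 * i) = Sum.inr l ∧ l.1 = planarLine τ t := by
    intro i
    by_cases hi : i < j
    · obtain ⟨l, hl⟩ := (hpar i).1 (by omega)
      obtain ⟨p, hp, hpl⟩ := incidenceGraph_adj_inr (hl ▸ hadj (2 * i) (by omega))
      obtain ⟨t, q, -, ht⟩ := hPL p p.2 l l.2 hpl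
      exact ⟨t, fun _ => ⟨l, hl, ht⟩⟩
    · exact ⟨0, fun h => absurd h hi⟩
  have hQ : ∀ i, ∃ q : Fin (2 * u + 3) → ℤ, i < j →
      ∃ p : P, w.getVert (2 * i + 1) = Sum.inl p ∧ p.1 = planarPoint τ q := by
    intro i
    by_cases hi : i < j
    · obtain ⟨p, hp⟩ := (hpar i).2 (by omega)
      obtain ⟨l, hl, hpl⟩ := incidenceGraph_adj_inl (hp ▸ hadj (2 * i + 1) (by omega))
      obtain ⟨t, q, hq, -⟩ := hPL p p.2 l l.2 hpl
      exact ⟨q, fun _ => ⟨p, hp, hq⟩⟩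
    · exact ⟨0, fun h => absurd h hi⟩
  choose t₀ ht₀ using hT
  choose q hq using hQ
  -- the last line of the closed path is its first
  let t : ℕ → Fin (2 * u + 3) → ℤ := fun i => if i = j then t₀ 0 else t₀ i
  have ht : ∀ i ≤ j, ∃ l : L, w.getVert (2 * i) = Sum.inr l ∧ l.1 = planarLine τ (t i) := by
    intro i hi
    rcases hi.eq_or_lt with rfl | hi
    · obtain ⟨l, hl, hl'⟩ := ht₀ 0 (by omega)
      refine ⟨l, ?_, by simpa [t] using hl'⟩
      rw [← hj, w.getVert_length, ← hl]
      simp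
    · simpa [t, hi.ne] using ht₀ i hi
  have hadj_iff : ∀ (p : P) (l : L), (incidenceGraph P L).Adj (Sum.inr l) (Sum.inl p) ↔
      p.1 ∈ l.1 := fun _ _ => Iff.rfl
  refine not_closed_of_incident (j := j) (by omega) (by omega) t q ?_ ?_ ?_ ?_ (by simp [t])
  · intro i hi
    obtain ⟨l, hl, hlt⟩ := ht i hi.le
    obtain ⟨p, hp, hpq⟩ := hq i hi
    have := hadj (2 * i) (by omega)
    rwa [hl, hp, hadj_iff, hlt, hpq, mem_planarLine hτ] at this
  · intro i hi
    obtain ⟨l, hl, hlt⟩ := ht (i + 1) hi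
    obtain ⟨p, hp, hpq⟩ := hq i hi
    have := (hadj (2 * i + 1) (by omega)).symm
    rwa [show 2 * i + 1 + 1 = 2 * (i + 1) by ring, hl, hp, hadj_iff, hlt, hpq,
      mem_planarLine hτ] at this
  · intro i hi heq
    obtain ⟨l, hl, hlt⟩ := ht i hi.le
    obtain ⟨l', hl', hlt'⟩ := ht (i + 1) hi
    have := hw.getVert_sub_one_ne_getVert_add_one (i := 2 * i + 1) (by omega)
    apply this
    rw [Nat.add_sub_cancel, show 2 * i + 1 + 1 = 2 * (i + 1) by ring, hl, hl']
    exact congrArg _ (Subtype.ext (by rw [hlt, hlt', heq]))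
  · intro i hi heq
    obtain ⟨p, hp, hpq⟩ := hq i (by omega)
    obtain ⟨p', hp', hpq'⟩ := hq (i + 1) hi
    have := hw.getVert_sub_one_ne_getVert_add_one (i := 2 * i + 2) (by omega)
    apply this
    rw [show 2 * i + 2 - 1 = 2 * i + 1 by omega, show 2 * i + 2 + 1 = 2 * (i + 1) + 1 by ring,
      hp, hp']
    exact congrArg _ (Subtype.ext (by rw [hpq, hpq', heq]))

/-- If every incidence between `P` and `L` is the projection of an incidence of integer vectors, then
the incidence graph inherits the girth of the algebraically defined graph. -/
theorem le_egirth_incidenceGraph {τ : ℝ} (hτ : Transcendental ℤ τ) {P : Finset Plane}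
    {L : Finset (AffineSubspace ℝ Plane)}
    (hPL : ∀ p ∈ P, ∀ l ∈ L, p ∈ l →
      ∃ t q : Fin (2 * u + 3) → ℤ, p = planarPoint τ q ∧ l = planarLine τ t) :
    ((2 * u + 8 : ℕ) : ℕ∞) ≤ (incidenceGraph P L).egirth := by
  classical
  refine SimpleGraph.le_egirth.mpr fun a w hw => ?_
  rw [Nat.cast_le]
  obtain ⟨l, hl⟩ : ∃ l : L, Sum.inr l ∈ w.support := by
    rcases a with p | l
    · have h3 := hw.three_le_length
      have h1 := w.adj_getVert_succ (i := 0) (by omega)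
      rw [w.getVert_zero] at h1
      obtain ⟨l, hl, -⟩ := incidenceGraph_adj_inl h1
      exact ⟨l, hl ▸ w.getVert_mem_support _⟩
    · exact ⟨l, w.start_mem_support⟩
  rw [← w.length_rotate _ hl]
  exact le_length_of_isCycle hτ hPL _ (SimpleGraph.Walk.isCycle_rotate hl |>.mpr hw)

/-! ### Adding isolated points and lines -/

/-- Points on the vertical axis that lie on no line, and vertical lines that contain no point, bring
a configuration of non-vertical lines to any larger size without new incidences. -/
theorem exists_isolated_extension {n : ℕ} {P₀ : Finset Plane}
    {L₀ : Finset (AffineSubspace ℝ Plane)} (hP : P₀.card ≤ n) (hL : L₀.card ≤ n)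
    (hL₀ : ∀ l ∈ L₀, ∃ m c, l = graphLine m c) :
    ∃ (P : Finset Plane) (L : Finset (AffineSubspace ℝ Plane)), P₀ ⊆ P ∧ L₀ ⊆ L ∧
      P.card = n ∧ L.card = n ∧ (∀ l ∈ L, IsLine l) ∧
      ∀ p ∈ P, ∀ l ∈ L, p ∈ l → p ∈ P₀ ∧ l ∈ L₀ := by
  classical
  have hinj : Function.Injective fun y : ℝ => (!₂[0, y] : Plane) := fun y y' h => by
    simpa using congrArg (fun v : Plane => v 1) h
  have hfin : {y : ℝ | !₂[0, y] ∈ P₀ ∨ ∃ l ∈ L₀, (!₂[0, y] : Plane) ∈ l}.Finite := by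
    rw [Set.ofPred_or]
    refine Set.Finite.union (P₀.finite_toSet.preimage hinj.injOn) ?_
    have : {y : ℝ | ∃ l ∈ L₀, (!₂[0, y] : Plane) ∈ l} =
        ⋃ l ∈ (L₀ : Set (AffineSubspace ℝ Plane)), {y : ℝ | (!₂[0, y] : Plane) ∈ l} := by
      ext y; simp
    rw [this]
    refine L₀.finite_toSet.biUnion fun l hl => ?_
    obtain ⟨m, c, rfl⟩ := hL₀ l hl
    refine (Set.finite_singleton c).subset fun y hy => ?_
    simpa using mem_graphLine.mp hy
  obtain ⟨Y, hY, hYc⟩ := hfin.infinite_compl.exists_subset_card_eq (n - P₀.card)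
  let P := P₀ ∪ Y.image fun y : ℝ => (!₂[0, y] : Plane)
  have hPc : P.card = n := by
    rw [Finset.card_union_of_disjoint, Finset.card_image_of_injective _ hinj, hYc]
    · omega
    · refine Finset.disjoint_left.mpr fun p hp hp' => ?_
      obtain ⟨y, hy, rfl⟩ := Finset.mem_image.mp hp'
      exact hY hy (Or.inl hp)
  have hfin' : {c : ℝ | c ∈ P.image fun p => p 0}.Finite := Finset.finite_toSet _
  obtain ⟨C, hC, hCc⟩ := hfin'.infinite_compl.exists_subset_card_eq (n - L₀.card)
  refine ⟨P, L₀ ∪ C.image verticalLine, Finset.subset_union_left, Finset.subset_union_left, hPc,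
    ?_, ?_, ?_⟩
  · rw [Finset.card_union_of_disjoint, Finset.card_image_of_injective _ verticalLine_injective,
      hCc]
    · omega
    · refine Finset.disjoint_left.mpr fun l hl hl' => ?_
      obtain ⟨c, -, rfl⟩ := Finset.mem_image.mp hl'
      obtain ⟨m, d, h⟩ := hL₀ _ hl
      exact graphLine_ne_verticalLine _ _ _ h.symm
  · intro l hl
    rcases Finset.mem_union.mp hl with hl | hl
    · obtain ⟨m, c, rfl⟩ := hL₀ l hl
      exact isLine_graphLine m c
    · obtain ⟨c, -, rfl⟩ := Finset.mem_image.mp hl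
      exact isLine_verticalLine c
  · intro p hp l hl hpl
    rcases Finset.mem_union.mp hl with hl | hl
    · refine ⟨?_, hl⟩
      rcases Finset.mem_union.mp hp with hp | hp
      · exact hp
      · obtain ⟨y, hy, rfl⟩ := Finset.mem_image.mp hp
        exact (hY hy (Or.inr ⟨l, hl, hpl⟩)).elim
    · obtain ⟨c, hc, rfl⟩ := Finset.mem_image.mp hl
      exact (hC hc (Finset.mem_image.mpr ⟨p, hp, mem_verticalLine.mp hpl⟩)).elim

/-! ### The configuration and its size -/

/-- The projected boxes of scale `m`, together with isolated points and lines. Each pair of a line of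
the box and an `x` in `[0, m)` gives an incidence. -/
theorem exists_configuration {u m n : ℕ} (hP : (pointBox u m).card ≤ n)
    (hL : m ^ totalWeight u ≤ n) :
    ∃ (P : Finset Plane) (L : Finset (AffineSubspace ℝ Plane)), P.card = n ∧ L.card = n ∧
      (∀ l ∈ L, IsLine l) ∧ ((2 * u + 8 : ℕ) : ℕ∞) ≤ (incidenceGraph P L).egirth ∧
      m ^ (totalWeight u + 1) ≤ (incidences P L).ncard := by
  classical
  have hτ := transcendental_liouvilleNumber (m := 2) le_rfl
  set τ : ℝ := liouvilleNumber (2 : ℕ)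
  obtain ⟨P, L, hP₀, hL₀, hPc, hLc, hline, hinc⟩ :=
    exists_isolated_extension (P₀ := (pointBox u m).image (planarPoint τ))
      (L₀ := (lineBox u m).image (planarLine τ)) (Finset.card_image_le.trans hP)
      (Finset.card_image_le.trans ((card_lineBox u m).trans_le hL)) (by
        intro l hl
        obtain ⟨t, -, rfl⟩ := Finset.mem_image.mp hl
        exact ⟨_, _, rfl⟩)
  refine ⟨P, L, hPc, hLc, hline, le_egirth_incidenceGraph hτ ?_, ?_⟩
  · intro p hp l hl hpl
    obtain ⟨hp, hl⟩ := hinc p hp l hl hpl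
    obtain ⟨q, -, rfl⟩ := Finset.mem_image.mp hp
    obtain ⟨t, -, rfl⟩ := Finset.mem_image.mp hl
    exact ⟨t, q, rfl, rfl⟩
  · have hfin : (incidences P L).Finite :=
      (P ×ˢ L).finite_toSet.subset fun x hx => Finset.mem_product.mpr ⟨hx.1, hx.2.1⟩
    let φ : (Fin (2 * u + 3) → ℤ) × ℤ → Plane × AffineSubspace ℝ Plane :=
      fun x => (planarPoint τ (pointOn x.1 x.2), planarLine τ x.1)
    have hφ : Function.Injective φ := by
      rintro ⟨t, x⟩ ⟨t', x'⟩ h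
      obtain ⟨h1, h2⟩ := Prod.mk.inj h
      obtain rfl : t = t' := planarLine_injective hτ h2
      have h3 := congrArg (fun q => coord q 0) (planarPoint_injective hτ h1)
      simp only [coord_pointOn_zero] at h3
      rw [h3]
    have hsub : (((lineBox u m ×ˢ Finset.Ico (0 : ℤ) m).image φ : Finset _) : Set _) ⊆
        incidences P L := by
      intro y hy
      obtain ⟨⟨t, x⟩, hx, rfl⟩ := Finset.mem_image.mp hy
      refine ⟨hP₀ (Finset.mem_image_of_mem _ (Finset.mem_image.mpr ⟨_, hx, rfl⟩)),
        hL₀ (Finset.mem_image_of_mem _ (Finset.mem_product.mp hx).1), ?_⟩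
      exact (mem_planarLine hτ).mpr (incident_pointOn t x)
    refine le_trans (le_of_eq ?_) (Set.ncard_le_ncard hsub hfin)
    rw [Set.ncard_coe_finset, Finset.card_image_of_injective _ hφ, Finset.card_product,
      card_lineBox, Int.card_Ico, sub_zero, Int.toNat_natCast, pow_succ]

/-- A scale `m` for which the configuration fits into `n` points, within a constant factor of the
best possible one. For small `n` the single line of the scale `m = 1` serves. -/
lemma exists_scale {u n : ℕ} (hn : 1 < n) : ∃ m : ℕ, 0 < m ∧ (pointBox u m).card ≤ n ∧
    m ^ totalWeight u ≤ n ∧ n ≤ 7 ^ (2 * u + 3) * (2 * m) ^ totalWeight u := by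
  classical
  have hD : totalWeight u ≠ 0 := by
    have := four_mul_totalWeight u
    intro h
    rw [h] at this
    nlinarith
  have h7 : 1 ≤ 7 ^ (2 * u + 3) := Nat.one_le_pow _ _ (by omega)
  have hex : ∃ m, n < 7 ^ (2 * u + 3) * (m + 1) ^ totalWeight u :=
    ⟨n, calc n < n + 1 := n.lt_succ_self
        _ ≤ (n + 1) ^ totalWeight u := Nat.le_self_pow hD _
        _ ≤ _ := Nat.le_mul_of_pos_left _ h7⟩
  have hlt := Nat.find_spec hex
  rcases Nat.eq_zero_or_pos (Nat.find hex) with h0 | h0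
  · rw [h0] at hlt
    refine ⟨1, one_pos, (card_pointBox_one_le u).trans hn.le, by simpa using hn.le, ?_⟩
    refine hlt.le.trans ?_
    gcongr
    norm_num
  · have hle := not_lt.mp (Nat.find_min hex (Nat.sub_lt h0 one_pos))
    rw [Nat.sub_add_cancel (show 1 ≤ Nat.find hex from h0)] at hle
    refine ⟨Nat.find hex, h0, (card_pointBox_le h0).trans hle,
      (Nat.le_mul_of_pos_left _ h7).trans hle, hlt.le.trans ?_⟩
    gcongr
    omega

end Coordinates

end PlaneIncidence

theorem theorem1 (k : ℕ) (hk : 3 ≤ k) (hodd : Odd k) :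
    ∃ c : ℝ, 0 < c ∧ ∀ n : ℕ, 1 < n →
      ∃ (P : Finset PlaneIncidence.Plane) (L : Finset (AffineSubspace ℝ PlaneIncidence.Plane)),
        P.card = n ∧ L.card = n ∧ (∀ l ∈ L, PlaneIncidence.IsLine l) ∧
        ((k + 5 : ℕ) : ℕ∞) ≤ (PlaneIncidence.incidenceGraph P L).egirth ∧
        c * (n : ℝ) ^ (1 + 4 / ((k : ℝ) ^ 2 + 6 * (k : ℝ) - 3)) ≤
          ((PlaneIncidence.incidences P L).ncard : ℝ) := by
  obtain ⟨u, rfl⟩ : ∃ u, k = 2 * u + 3 := by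
    obtain ⟨v, rfl⟩ := hodd
    exact ⟨v - 1, by omega⟩
  set D := PlaneIncidence.totalWeight u
  have hD4 : (4 : ℝ) * D = ((2 * u + 3 : ℕ) : ℝ) ^ 2 + 6 * ((2 * u + 3 : ℕ) : ℝ) - 3 := by
    rw [eq_sub_iff_add_eq]
    exact_mod_cast PlaneIncidence.four_mul_totalWeight u
  have hD : (0 : ℝ) < D := by
    push_cast at hD4
    nlinarith [(Nat.cast_nonneg u : (0 : ℝ) ≤ u)]
  rw [← hD4, show (4 : ℝ) / (4 * D) = 1 / D by field_simp]
  set K : ℝ := 7 ^ (2 * u + 3) * 2 ^ D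
  have hK : 0 < K := by positivity
  refine ⟨(K ^ (1 + 1 / (D : ℝ)))⁻¹, by positivity, fun n hn => ?_⟩
  obtain ⟨m, hm, hP, hL, hnm⟩ := PlaneIncidence.exists_scale (u := u) hn
  obtain ⟨P, L, hPc, hLc, hline, hgirth, hcount⟩ :=
    PlaneIncidence.exists_configuration hP hL
  refine ⟨P, L, hPc, hLc, hline, hgirth, ?_⟩
  have hnK : (n : ℝ) ≤ K * (m : ℝ) ^ D := by
    calc (n : ℝ) ≤ ((7 ^ (2 * u + 3) * (2 * m) ^ D : ℕ) : ℝ) := by exact_mod_cast hnm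
      _ = K * (m : ℝ) ^ D := by push_cast; rw [mul_pow, ← mul_assoc]
  rw [inv_mul_le_iff₀ (by positivity)]
  calc (n : ℝ) ^ (1 + 1 / (D : ℝ)) ≤ (K * (m : ℝ) ^ D) ^ (1 + 1 / (D : ℝ)) := by gcongr
    _ = K ^ (1 + 1 / (D : ℝ)) * (m : ℝ) ^ (D + 1) := by
      rw [Real.mul_rpow hK.le (by positivity), ← Real.rpow_natCast (m : ℝ) D, ← Real.rpow_mul
        (by positivity), show (D : ℝ) * (1 + 1 / D) = ((D + 1 : ℕ) : ℝ) by push_cast; field_simp,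
        Real.rpow_natCast]
    _ ≤ _ := by
      gcongr
      exact_mod_cast hcount
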